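/- For real $a<1$, $b<1$ and $t>0$ let $$h_{a,b}(t)=\frac1{\sqrt{4\pi t}}\int_0^1\int_0^1 e^{-(x-y)^2/(4t)}\,x^{-a}y^{-b}\,dx\,dy$$ be the heat content of $[0,1]$ in $\mathbb{R}$ with initial temperature $x^{-a}$ and specific heat $y^{-b}$, and let $$S=\{(a,b)\in\mathbb{R}^2: a<1,\ b<1,\ a+b=1-2k\text{ for some integer }k\ge 0\}.$$ There exist functions $\tilde c_n(a,b)$, $n=0,1,2,\dots$, each real analytic in $(a,b)$ on a neighbourhood of $S$ in $\mathbb{R}^2$, such that for every $(a,b)\in S$ with $a+b=1-2k$ and every integer $N\ge 2k+1$, $$h_{a,b}(t)=\sum_{n=0}^N\tilde c_n(a,b)\,t^{n/2}-\frac{a(a+1)\cdots(a+2k-1)}{2\cdot k!}\,t^k\log t+O\bigl(t^{(N+1)/2}\bigr)\qquad\text{as }t\downarrow0,$$ where the product $a(a+1)\cdots(a+2k-1)$ is $1$ if $k=0$, and the implied constant may depend on $a,b,N$. -/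

import Mathlib

open Filter Topology Asymptotics

noncomputable section

/-- The heat kernel of `-∂²/∂x²` on the real line at time `t > 0`. -/
def heatKernel (x y t : ℝ) : ℝ :=
  1 / Real.sqrt (4 * Real.pi * t) * Real.exp (-(x - y) ^ 2 / (4 * t))

/-- The heat content of `[0,1]` in `ℝ` at time `t`, for the initial temperature `φ` and
the specific heat `ρ`. -/
def heatContent (φ ρ : ℝ → ℝ) (t : ℝ) : ℝ :=
  ∫ y in (0 : ℝ)..1, ∫ x in (0 : ℝ)..1, heatKernel x y t * φ x * ρ y

/-- The interval heat content `h_{a,b}(t)`: the initial temperature is `x^{-a}` and the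
specific heat is `x^{-b}`. -/
def intervalHeatContent (a b t : ℝ) : ℝ :=
  heatContent (fun x => x ^ (-a)) (fun y => y ^ (-b)) t

/-- The rising factorial `θ_n(a) = a (a + 1) ⋯ (a + n - 1)`, with `θ_0(a) = 1`. -/
def theta (n : ℕ) (a : ℝ) : ℝ :=
  ∏ j ∈ Finset.range n, (a + (j : ℝ))

end

/-!
Write `m = 1 - a - b = 2 * k`. Cutting the unit square along its diagonal and substituting
`x = y * (1 - s)` on the triangle `x < y` (and symmetrically on the other one) turns the factor
`x ^ (-a) * y ^ (-b) dx dy` into `(1 - s) ^ (-a) * y ^ m ds dy`. With `u = y * s` and Fubini this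
gives

  `h_{a,b}(t) = π^(-1/2) ∫_0^∞ exp (-v²) (g_a (2 √t v) + g_b (2 √t v)) dv`,
  `g_a u = u ^ m * ∫_u^1 s ^ (-m-1) (1 - s) ^ (-a) ds`,

so that only the behaviour of `g_a` at `u = 0` matters (`intervalHeatContent_eq`).

The integral defining `g_a` is an incomplete beta function, `betaTail`. Integration by parts lowers
`m` by one, at the cost of a power of `1 - u` (`betaTail_succ`), and for `m = 0` the integral is
`-log u` plus a constant plus the primitive of a function with a power series at `0`. Hence
`g_a u = ∑ e_j(a) u ^ j - θ_m(a) / m! * u ^ m * log u` asymptotically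
(`hasPowerExpansion_betaTail`). All `e_j` are polynomials in `a` and in the constant of the case
`m = 0`, which is the value at `-a` of a Mellin transform up to the factor `-a`; they are therefore
analytic for `a < 1` (`analyticOnNhd_betaCoeff`).

Since the remainder is bounded by a multiple of `u ^ N` on the whole half-line, the expansion can be
averaged termwise against `exp (-v²)` (`exists_bound_integral_betaTail`). The term `u ^ m * log u`
produces `t ^ k * log t`; the reflection `θ_{2k}(b) = θ_{2k}(a)` and the value of the Gaussian moment
of order `2 * k` give its coefficient. Each coefficient `c n` is one analytic function near each of
the segments `a + b = 1 - 2 * k`; these are at positive distance from one another, and the nearest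
one is selected by `segmentIndex`.
-/

/-! ### Asymptotic power series at the origin -/

/-- `f` has the asymptotic power series `∑ c j * u ^ j` as `u ↓ 0`; the series need not converge. -/
def HasPowerExpansion (f : ℝ → ℝ) (c : ℕ → ℝ) : Prop :=
  ∀ N : ℕ, (fun u : ℝ => f u - ∑ j ∈ Finset.range N, c j * u ^ j) =O[𝓝[>] 0] fun u : ℝ => u ^ N

/-- The coefficients of a power series multiplied by its variable. -/
def shiftCoeff (c : ℕ → ℝ) : ℕ → ℝ
  | 0 => 0
  | j + 1 => c j

lemma isBigO_pow_of_le {M N : ℕ} (h : M ≤ N) :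
    (fun u : ℝ => u ^ N) =O[𝓝[>] 0] fun u : ℝ => u ^ M := by
  refine IsBigO.of_bound 1 ?_
  filter_upwards [Ioo_mem_nhdsGT (one_pos : (0 : ℝ) < 1)] with u hu
  rw [one_mul, norm_pow, norm_pow, Real.norm_of_nonneg hu.1.le]
  exact pow_le_pow_of_le_one hu.1.le hu.2.le h

namespace HasPowerExpansion

variable {f g : ℝ → ℝ} {c d : ℕ → ℝ}

lemma of_succ (h : ∀ N : ℕ, (fun u : ℝ => f u - ∑ j ∈ Finset.range (N + 1), c j * u ^ j)
    =O[𝓝[>] 0] fun u : ℝ => u ^ (N + 1)) : HasPowerExpansion f c := by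
  rintro (_ | N)
  · have h1 := (h 0).trans (isBigO_pow_of_le (Nat.zero_le _))
    have h2 : (fun _ : ℝ => c 0) =O[𝓝[>] 0] fun u : ℝ => u ^ 0 := by
      simpa using isBigO_const_const (c 0) (one_ne_zero (α := ℝ)) (𝓝[>] 0)
    refine (h1.add h2).congr_left fun u => ?_
    simp
  · exact h N

lemma congr' (h : HasPowerExpansion f c) (hfg : f =ᶠ[𝓝[>] 0] g) : HasPowerExpansion g c :=
  fun N => (h N).congr' (hfg.mono fun u hu => by simp only [hu]) EventuallyEq.rfl

lemma congr_coeff (h : HasPowerExpansion f c) (hcd : ∀ j, c j = d j) : HasPowerExpansion f d := by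
  rwa [← funext hcd]

lemma add (hf : HasPowerExpansion f c) (hg : HasPowerExpansion g d) :
    HasPowerExpansion (fun u => f u + g u) (fun j => c j + d j) := fun N =>
  ((hf N).add (hg N)).congr_left fun u => by
    simp only [add_mul, Finset.sum_add_distrib]; ring

lemma const_mul (hf : HasPowerExpansion f c) (r : ℝ) :
    HasPowerExpansion (fun u => r * f u) (fun j => r * c j) := fun N =>
  ((hf N).const_mul_left r).congr_left fun u => by
    simp only [mul_sub, Finset.mul_sum, mul_assoc]

lemma const (r : ℝ) : HasPowerExpansion (fun _ => r) (fun j => if j = 0 then r else 0) :=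
  of_succ fun N => by
    refine (isBigO_zero _ _).congr_left fun u => ?_
    simp

lemma id_mul (hf : HasPowerExpansion f c) :
    HasPowerExpansion (fun u => u * f u) (shiftCoeff c) := of_succ fun N => by
  refine ((isBigO_refl (fun u : ℝ => u) (𝓝[>] 0)).mul (hf N)).congr (fun u => ?_) fun u => ?_
  · simp only [Finset.sum_range_succ', shiftCoeff, mul_sub, Finset.mul_sum, zero_mul, add_zero]
    congr 1
    exact Finset.sum_congr rfl fun j _ => by ring
  · ring

lemma sub_div_id (hf : HasPowerExpansion f c) :
    HasPowerExpansion (fun u => (f u - c 0) / u) (fun j => c (j + 1)) := fun N => by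
  refine ((isBigO_refl (fun u : ℝ => u⁻¹) (𝓝[>] 0)).mul (hf (N + 1))).congr' ?_ ?_
  · filter_upwards [self_mem_nhdsWithin] with u hu
    have hu' : u ≠ 0 := ne_of_gt hu
    rw [Finset.sum_range_succ', eq_comm, div_sub' hu', div_eq_inv_mul]
    congr 1
    rw [Finset.mul_sum, pow_zero, mul_one, add_comm, ← sub_sub]
    congr 1
    exact Finset.sum_congr rfl fun j _ => by ring
  · filter_upwards [self_mem_nhdsWithin] with u hu
    have hu' : u ≠ 0 := ne_of_gt hu
    field_simp
    ring

end HasPowerExpansion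

/-- Integration of a truncated asymptotic power series. -/
lemma isBigO_integral_sub_sum {f : ℝ → ℝ} {c : ℕ → ℝ} {N : ℕ}
    (hint : ∀ᶠ u in 𝓝[>] (0 : ℝ), IntervalIntegrable f MeasureTheory.volume 0 u)
    (h : (fun u : ℝ => f u - ∑ j ∈ Finset.range N, c j * u ^ j) =O[𝓝[>] 0] fun u : ℝ => u ^ N) :
    (fun u : ℝ => (∫ s in (0 : ℝ)..u, f s) -
      ∑ j ∈ Finset.range N, c j / ((j : ℝ) + 1) * u ^ (j + 1)) =O[𝓝[>] 0]
      fun u : ℝ => u ^ (N + 1) := by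
  obtain ⟨C, hC⟩ := h.bound
  obtain ⟨δ, hδ, hδC⟩ := mem_nhdsGT_iff_exists_Ioo_subset.1 hC
  refine IsBigO.of_bound C ?_
  filter_upwards [hint, Ioo_mem_nhdsGT hδ] with u hu huδ
  have hsum : ∑ j ∈ Finset.range N, c j / ((j : ℝ) + 1) * u ^ (j + 1)
      = ∫ s in (0 : ℝ)..u, ∑ j ∈ Finset.range N, c j * s ^ j := by
    rw [intervalIntegral.integral_finsetSum
      fun j _ => (by fun_prop : Continuous fun s : ℝ => c j * s ^ j).intervalIntegrable _ _]
    refine Finset.sum_congr rfl fun j _ => ?_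
    simp [integral_pow]
    ring
  have hcont : Continuous fun s : ℝ => ∑ j ∈ Finset.range N, c j * s ^ j := by fun_prop
  rw [hsum, ← intervalIntegral.integral_sub hu (hcont.intervalIntegrable 0 u)]
  have hb : ∀ s ∈ Set.uIoc 0 u, ‖f s - ∑ j ∈ Finset.range N, c j * s ^ j‖ ≤ C * u ^ N := by
    intro s hs
    rw [Set.uIoc_of_le huδ.1.le] at hs
    have h1 : ‖f s - ∑ j ∈ Finset.range N, c j * s ^ j‖ ≤ C * ‖s ^ N‖ :=
      hδC ⟨hs.1, hs.2.trans_lt huδ.2⟩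
    have h3 : 0 < ‖s ^ N‖ := by
      rw [norm_pos_iff]; exact pow_ne_zero _ hs.1.ne'
    have h2 : 0 ≤ C := nonneg_of_mul_nonneg_left ((norm_nonneg _).trans h1) h3
    refine h1.trans (mul_le_mul_of_nonneg_left ?_ h2)
    rw [Real.norm_of_nonneg (pow_nonneg hs.1.le _)]
    exact pow_le_pow_left₀ hs.1.le hs.2 _
  refine (intervalIntegral.norm_integral_le_of_norm_le_const hb).trans (le_of_eq ?_)
  rw [Real.norm_of_nonneg (pow_nonneg huδ.1.le _), sub_zero, abs_of_pos huδ.1]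
  ring

lemma HasPowerExpansion.integral {f : ℝ → ℝ} {c : ℕ → ℝ} (h : HasPowerExpansion f c)
    (hint : ∀ᶠ u in 𝓝[>] (0 : ℝ), IntervalIntegrable f MeasureTheory.volume 0 u) :
    HasPowerExpansion (fun u => ∫ s in (0 : ℝ)..u, f s)
      (shiftCoeff fun j => c j / ((j : ℝ) + 1)) := .of_succ fun N => by
  simpa [Finset.sum_range_succ', shiftCoeff] using isBigO_integral_sub_sum hint (h N)

lemma theta_succ' (n : ℕ) (a : ℝ) : theta (n + 1) a = a * theta n (a + 1) := by
  unfold theta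
  rw [Finset.prod_range_succ', mul_comm]
  simp only [Nat.cast_zero, add_zero, Nat.cast_add, Nat.cast_one]
  congr 1
  exact Finset.prod_congr rfl fun j _ => by ring

lemma theta_succ (n : ℕ) (a : ℝ) : theta (n + 1) a = theta n a * (a + n) := by
  unfold theta
  rw [Finset.prod_range_succ]

lemma hasDerivAt_one_sub_rpow {s : ℝ} (hs : s < 1) (a : ℝ) :
    HasDerivAt (fun s : ℝ => (1 - s) ^ (-a)) (a * (1 - s) ^ (-(a + 1))) s := by
  have h := ((hasDerivAt_id s).const_sub 1).rpow_const (p := -a) (Or.inl (by simp; linarith))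
  refine h.congr_deriv ?_
  rw [show -(a + 1) = -a - 1 by ring, id]
  ring

lemma continuousOn_one_sub_rpow (a : ℝ) :
    ContinuousOn (fun s : ℝ => (1 - s) ^ (-a)) (Set.Iio 1) := fun _ hs =>
  (hasDerivAt_one_sub_rpow hs a).continuousAt.continuousWithinAt

/-- The binomial series, as an asymptotic expansion. -/
lemma hasPowerExpansion_one_sub_rpow (a : ℝ) :
    HasPowerExpansion (fun s => (1 - s) ^ (-a)) fun j => theta j a / j.factorial := by
  intro N
  induction N generalizing a with
  | zero =>
    have h : Tendsto (fun s : ℝ => (1 - s) ^ (-a)) (𝓝[>] 0) (𝓝 ((1 - 0) ^ (-a))) :=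
      (hasDerivAt_one_sub_rpow one_pos a).continuousAt.tendsto.mono_left nhdsWithin_le_nhds
    simpa using h.isBigO_one ℝ
  | succ N ih =>
    have hint : ∀ u ∈ Set.Ioo (0 : ℝ) 1, IntervalIntegrable (fun s : ℝ => (1 - s) ^ (-(a + 1)))
        MeasureTheory.volume 0 u := fun u hu => by
      refine ContinuousOn.intervalIntegrable
        ((continuousOn_one_sub_rpow _).mono fun s hs => ?_)
      rw [Set.uIcc_of_le hu.1.le] at hs
      exact hs.2.trans_lt hu.2
    have h := (isBigO_integral_sub_sum (by
      filter_upwards [Ioo_mem_nhdsGT (one_pos : (0 : ℝ) < 1)] with u hu using hint u hu)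
      (ih (a + 1))).const_mul_left a
    refine h.congr' ?_ EventuallyEq.rfl
    filter_upwards [Ioo_mem_nhdsGT (one_pos : (0 : ℝ) < 1)] with u hu
    have hftc : ∫ s in (0 : ℝ)..u, a * (1 - s) ^ (-(a + 1)) = (1 - u) ^ (-a) - 1 := by
      rw [intervalIntegral.integral_eq_sub_of_hasDerivAt (f := fun s : ℝ => (1 - s) ^ (-a))
        _ ((hint u hu).const_mul a)]
      · simp
      · intro s hs
        rw [Set.uIcc_of_le hu.1.le] at hs
        exact hasDerivAt_one_sub_rpow (hs.2.trans_lt hu.2) a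
    rw [mul_sub, ← intervalIntegral.integral_const_mul, hftc, Finset.sum_range_succ',
      Finset.mul_sum]
    have : ∀ j ∈ Finset.range N, a * (theta j (a + 1) / (j.factorial : ℝ) / ((j : ℝ) + 1)
        * u ^ (j + 1)) = theta (j + 1) a / ((j + 1).factorial : ℝ) * u ^ (j + 1) := by
      intro j _
      rw [theta_succ', Nat.factorial_succ]
      push_cast
      field_simp
    rw [Finset.sum_congr rfl this]
    simp [theta]
    ring

/-! ### The incomplete beta integral and its expansion -/

/-- The incomplete beta integral `∫_u^1 s^(-m-1) (1 - s)^(-a) ds`; it vanishes for `u ≥ 1`. -/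
noncomputable def betaTail (m : ℕ) (a u : ℝ) : ℝ :=
  ∫ s in Set.Ioc u 1, (1 - s) ^ (-a) / s ^ (m + 1)

lemma integrableOn_one_sub_rpow {a : ℝ} (ha : a < 1) :
    MeasureTheory.IntegrableOn (fun s : ℝ => (1 - s) ^ (-a)) (Set.Ioc 0 1) := by
  have h := (intervalIntegral.intervalIntegrable_rpow' (a := 0) (b := 1)
    (by linarith : -1 < -a)).comp_sub_left 1
  have h2 := h.symm
  simp only [sub_zero, sub_self] at h2
  exact (intervalIntegrable_iff_integrableOn_Ioc_of_le zero_le_one).1 h2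

lemma integrableOn_one_sub_rpow_div {a : ℝ} (ha : a < 1) (m : ℕ) {u : ℝ} (hu : 0 < u) :
    MeasureTheory.IntegrableOn (fun s : ℝ => (1 - s) ^ (-a) / s ^ m) (Set.Ioc u 1) := by
  refine MeasureTheory.Integrable.mono' (((integrableOn_one_sub_rpow ha).mono_set
    (Set.Ioc_subset_Ioc_left hu.le)).div_const (u ^ m)) ?_ ?_
  · exact (by fun_prop : Measurable fun s : ℝ => (1 - s) ^ (-a) / s ^ m).aestronglyMeasurable
  · refine (MeasureTheory.ae_restrict_iff' measurableSet_Ioc).2 (Eventually.of_forall ?_)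
    intro s hs
    have h1 : 0 ≤ (1 - s) ^ (-a) := Real.rpow_nonneg (by linarith [hs.2]) _
    rw [Real.norm_of_nonneg (div_nonneg h1 (pow_nonneg (hu.trans hs.1).le _))]
    exact div_le_div_of_nonneg_left h1 (pow_pos hu _) (pow_le_pow_left₀ hu.le hs.1.le _)

lemma continuousOn_betaTail {a : ℝ} (ha : a < 1) (m : ℕ) :
    ContinuousOn (betaTail m a) (Set.Ioi 0) := by
  intro u₀ hu₀
  have hδ : 0 < u₀ / 2 := half_pos hu₀
  have hint : MeasureTheory.Integrable (Set.indicator (Set.Ioc (u₀ / 2) 1)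
      fun s : ℝ => (1 - s) ^ (-a) / s ^ (m + 1)) :=
    (integrableOn_one_sub_rpow_div ha (m + 1) hδ).integrable_indicator measurableSet_Ioc
  set F := Set.indicator (Set.Ioc (u₀ / 2) 1) fun s : ℝ => (1 - s) ^ (-a) / s ^ (m + 1) with hF
  have hcont : Continuous fun u => ∫ s in Set.Ioi u, F s := by
    have h1 : (fun u => ∫ s in Set.Ioi u, F s)
        = fun u => (∫ s in Set.Ioi 0, F s) - ∫ s in (0 : ℝ)..u, F s := by
      funext u
      rw [← intervalIntegral.integral_Ioi_sub_Ioi' hint.integrableOn hint.integrableOn]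
      ring
    rw [h1]
    exact continuous_const.sub (intervalIntegral.continuous_primitive
      (fun _ _ => hint.intervalIntegrable) 0)
  refine ContinuousAt.continuousWithinAt (hcont.continuousAt.congr ?_)
  filter_upwards [Ioi_mem_nhds (half_lt_self hu₀)] with u hu
  rw [hF, MeasureTheory.setIntegral_indicator measurableSet_Ioc, betaTail]
  congr 2
  ext s
  simp only [Set.mem_inter_iff, Set.mem_Ioi, Set.mem_Ioc] at hu ⊢
  constructor
  · rintro ⟨h1, _, h3⟩; exact ⟨h1, h3⟩
  · rintro ⟨h1, h3⟩; exact ⟨h1, hu.trans h1, h3⟩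

/-- Integration by parts lowers the order of the pole at the origin. -/
lemma betaTail_succ {a : ℝ} (ha : a < 1) (m : ℕ) {u : ℝ} (hu : u ∈ Set.Ioo (0 : ℝ) 1) :
    ((m : ℝ) + 1) * betaTail (m + 1) a u
      = (m + a) * betaTail m a u + (1 - u) ^ (1 - a) / u ^ (m + 1) := by
  have hi : ∀ n : ℕ, IntervalIntegrable (fun s : ℝ => (1 - s) ^ (-a) / s ^ n)
      MeasureTheory.volume u 1 := fun n =>
    (intervalIntegrable_iff_integrableOn_Ioc_of_le hu.2.le).2
      (integrableOn_one_sub_rpow_div ha n hu.1)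
  have hV : ∀ n : ℕ, betaTail n a u = ∫ s in u..1, (1 - s) ^ (-a) / s ^ (n + 1) := fun n =>
    (intervalIntegral.integral_of_le hu.2.le).symm
  have hftc := intervalIntegral.integral_eq_sub_of_hasDerivAt_of_le hu.2.le
    (f := fun s : ℝ => (1 - s) ^ (1 - a) / s ^ (m + 1))
    (f' := fun s : ℝ => (m + a) * ((1 - s) ^ (-a) / s ^ (m + 1))
      - ((m : ℝ) + 1) * ((1 - s) ^ (-a) / s ^ (m + 2))) ?_ ?_
    (((hi _).const_mul _).sub ((hi _).const_mul _))
  · rw [intervalIntegral.integral_sub ((hi _).const_mul _) ((hi _).const_mul _),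
      intervalIntegral.integral_const_mul, intervalIntegral.integral_const_mul, ← hV m,
      ← hV (m + 1), sub_self, Real.zero_rpow (by linarith), zero_div] at hftc
    linarith
  · refine ContinuousOn.div (ContinuousOn.rpow_const (by fun_prop) ?_) (by fun_prop) ?_
    · intro s _; right; linarith
    · intro s hs; exact pow_ne_zero _ (hu.1.trans_le hs.1).ne'
  · intro s hs
    have hs0 : s ≠ 0 := (hu.1.trans hs.1).ne'
    have h1 : HasDerivAt (fun s : ℝ => (1 - s) ^ (1 - a)) ((a - 1) * (1 - s) ^ (-a)) s := by
      simpa using hasDerivAt_one_sub_rpow hs.2 (a - 1)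
    refine (h1.div (hasDerivAt_pow (m + 1) s) (pow_ne_zero _ hs0)).congr_deriv ?_
    have h2 : (1 - s) ^ (1 - a) = (1 - s) * (1 - s) ^ (-a) := by
      rw [sub_eq_add_neg 1 a, Real.rpow_add (by linarith [hs.2]), Real.rpow_one]
    rw [h2]
    push_cast
    field_simp
    ring

/-- The constant term `∫_0^1 ((1 - s)^(-a) - 1) / s ds` of `betaTail 0 a u + log u` at `u = 0`. -/
noncomputable def betaConst (a : ℝ) : ℝ :=
  ∫ s in (0 : ℝ)..1, ((1 - s) ^ (-a) - 1) / s

lemma intervalIntegrable_one_sub_rpow_sub_one_div {a : ℝ} (ha : a < 1) :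
    IntervalIntegrable (fun s : ℝ => ((1 - s) ^ (-a) - 1) / s) MeasureTheory.volume 0 1 := by
  obtain ⟨C, hC⟩ := ((hasPowerExpansion_one_sub_rpow a).sub_div_id 0).bound
  obtain ⟨δ, hδ, hδC⟩ := mem_nhdsGT_iff_exists_Ioo_subset.1 hC
  have hmeas : Measurable fun s : ℝ => ((1 - s) ^ (-a) - 1) / s := by fun_prop
  rw [intervalIntegrable_iff_integrableOn_Ioc_of_le zero_le_one]
  -- The integrand is bounded near `0`; away from `0` it is dominated by the integrable weight.
  refine MeasureTheory.Integrable.mono' (g := fun s => |C| + ((1 - s) ^ (-a) + 1) / δ) ?_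
    hmeas.aestronglyMeasurable ?_
  · exact (MeasureTheory.integrable_const _).add
      ((MeasureTheory.Integrable.add (integrableOn_one_sub_rpow ha)
        (MeasureTheory.integrable_const _)).div_const _)
  · refine (MeasureTheory.ae_restrict_iff' measurableSet_Ioc).2 (Eventually.of_forall ?_)
    intro s hs
    have h1 : 0 ≤ (1 - s) ^ (-a) := Real.rpow_nonneg (by linarith [hs.2]) _
    have hδ0 : 0 < δ := hδ
    rcases lt_or_ge s δ with h | h
    · have := hδC ⟨hs.1, h⟩
      simp only [Finset.range_zero, Finset.sum_empty, pow_zero, theta, Finset.prod_empty,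
        Nat.factorial_zero, Nat.cast_one, div_one, sub_zero, norm_one, mul_one,
        Set.mem_ofPred_eq] at this
      have h3 : 0 ≤ ((1 - s) ^ (-a) + 1) / δ := by positivity
      linarith [le_abs_self C]
    · rw [norm_div, Real.norm_of_nonneg hs.1.le]
      have h2 : ‖(1 - s) ^ (-a) - 1‖ ≤ (1 - s) ^ (-a) + 1 := by
        rw [Real.norm_eq_abs, abs_le]; constructor <;> linarith
      have h4 := div_le_div₀ (by positivity) h2 hδ0 h
      linarith [abs_nonneg C]

lemma betaTail_zero {a : ℝ} (ha : a < 1) {u : ℝ} (hu : u ∈ Set.Ioo (0 : ℝ) 1) :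
    betaTail 0 a u = -Real.log u + betaConst a - ∫ s in (0 : ℝ)..u, ((1 - s) ^ (-a) - 1) / s := by
  have hp := intervalIntegrable_one_sub_rpow_sub_one_div ha
  have hp1 : IntervalIntegrable (fun s : ℝ => ((1 - s) ^ (-a) - 1) / s) MeasureTheory.volume 0 u :=
    hp.mono_set (by
      rw [Set.uIcc_of_le hu.1.le, Set.uIcc_of_le zero_le_one]; exact Set.Icc_subset_Icc_right hu.2.le)
  have hp2 : IntervalIntegrable (fun s : ℝ => ((1 - s) ^ (-a) - 1) / s) MeasureTheory.volume u 1 :=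
    hp.mono_set (by
      rw [Set.uIcc_of_le hu.2.le, Set.uIcc_of_le zero_le_one]; exact Set.Icc_subset_Icc_left hu.1.le)
  have h0 : (0 : ℝ) ∉ Set.uIcc u 1 := by
    rw [Set.uIcc_of_le hu.2.le]; intro h; exact absurd h.1 (not_le.2 hu.1)
  have hinv : IntervalIntegrable (fun s : ℝ => s⁻¹) MeasureTheory.volume u 1 := by
    simpa using intervalIntegrable_inv_iff.2 (Or.inr h0)
  rw [betaTail, ← intervalIntegral.integral_of_le hu.2.le, betaConst,
    ← intervalIntegral.integral_add_adjacent_intervals hp1 hp2, show -Real.log u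
      = ∫ s in u..1, s⁻¹ by rw [integral_inv h0, one_div, Real.log_inv]]
  rw [show ∀ x y z : ℝ, x + (y + z) - y = x + z by intros; ring,
    ← intervalIntegral.integral_add hinv hp2]
  refine intervalIntegral.integral_congr fun s _ => ?_
  simp only [zero_add, pow_one]
  ring

/-- The coefficients of the regular part of the expansion of `u ^ m * betaTail m a u`. -/
noncomputable def betaCoeff : ℕ → ℕ → ℝ → ℝ
  | 0, 0, a => betaConst a
  | 0, j + 1, a => -(theta (j + 1) a / (j + 1).factorial / ((j : ℝ) + 1))
  | m + 1, 0, _ => ((m : ℝ) + 1)⁻¹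
  | m + 1, j + 1, a => ((m : ℝ) + 1)⁻¹ *
      ((m + a) * betaCoeff m j a + theta (j + 1) (a - 1) / (j + 1).factorial)

lemma hasPowerExpansion_betaTail {a : ℝ} (ha : a < 1) (m : ℕ) :
    HasPowerExpansion (fun u => u ^ m * betaTail m a u
      + theta m a / m.factorial * (u ^ m * Real.log u)) fun j => betaCoeff m j a := by
  induction m with
  | zero =>
    have h := (HasPowerExpansion.const (betaConst a)).add
      (((hasPowerExpansion_one_sub_rpow a).sub_div_id.integral ?_).const_mul (-1))
    · refine (h.congr_coeff (d := fun j => betaCoeff 0 j a) ?_).congr' ?_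
      · rintro (_ | j) <;> simp [betaCoeff, shiftCoeff]
      · filter_upwards [Ioo_mem_nhdsGT (one_pos : (0 : ℝ) < 1)] with u hu
        rw [betaTail_zero ha hu]
        simp [theta]
        ring
    · filter_upwards [Ioo_mem_nhdsGT (one_pos : (0 : ℝ) < 1)] with u hu
      simp only [theta, Finset.range_zero, Finset.prod_empty, Nat.factorial_zero, Nat.cast_one,
        div_one]
      refine (intervalIntegrable_one_sub_rpow_sub_one_div ha).mono_set ?_
      rw [Set.uIcc_of_le hu.1.le, Set.uIcc_of_le zero_le_one]
      exact Set.Icc_subset_Icc_right hu.2.le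
  | succ m ih =>
    have h := (((ih.const_mul (m + a)).id_mul).add
      (hasPowerExpansion_one_sub_rpow (a - 1))).const_mul (((m : ℝ) + 1)⁻¹)
    refine (h.congr_coeff (d := fun j => betaCoeff (m + 1) j a) ?_).congr' ?_
    · rintro (_ | j) <;> simp [betaCoeff, shiftCoeff, theta]
    · filter_upwards [Ioo_mem_nhdsGT (one_pos : (0 : ℝ) < 1)] with u hu
      have hm : (m : ℝ) + 1 ≠ 0 := by positivity
      have hu0 : u ≠ 0 := hu.1.ne'
      have hrec := betaTail_succ ha m hu
      rw [← mul_right_inj' hm, mul_inv_cancel_left₀ hm, neg_sub, theta_succ, Nat.factorial_succ]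
      have hpow : (1 - u) ^ (1 - a) = u ^ (m + 1) * ((m + 1) * betaTail (m + 1) a u
          - (m + a) * betaTail m a u) := by
        rw [hrec]; field_simp; ring
      rw [hpow]
      push_cast
      field_simp
      ring

/-! ### Analyticity of the coefficients -/

/-- The function whose Mellin transform at `-a` is, up to the factor `-a`, `betaConst a`. -/
noncomputable def logOneSub : ℝ → ℂ :=
  Set.indicator (Set.Ioo 0 1) fun r : ℝ => (Real.log (1 - r) : ℂ)

lemma integrable_logOneSub : MeasureTheory.Integrable logOneSub := by
  have h := ((intervalIntegral.intervalIntegrable_log' (a := 0) (b := 1)).comp_sub_left 1).symm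
  simp only [sub_zero, sub_self] at h
  have h2 := (intervalIntegrable_iff_integrableOn_Ioo_of_le zero_le_one).1 h
  have h3 : MeasureTheory.IntegrableOn (fun r : ℝ => (Real.log (1 - r) : ℂ)) (Set.Ioo 0 1) :=
    MeasureTheory.Integrable.ofReal h2
  exact h3.integrable_indicator measurableSet_Ioo

lemma logOneSub_isBigO_atTop (p : ℝ) : logOneSub =O[atTop] fun x : ℝ => x ^ p := by
  refine (isBigO_zero _ _).congr' ?_ EventuallyEq.rfl
  filter_upwards [eventually_ge_atTop 1] with x hx
  rw [logOneSub, Set.indicator_of_notMem (fun h => not_lt.2 hx h.2)]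

lemma logOneSub_isBigO_zero : logOneSub =O[𝓝[>] 0] fun x : ℝ => x ^ (-(-1) : ℝ) := by
  have h : HasDerivAt (fun x : ℝ => Real.log (1 - x)) (-1 / (1 - 0)) 0 :=
    ((hasDerivAt_id (0 : ℝ)).const_sub 1).log (by simp)
  have h2 := h.isBigO_sub.mono (nhdsWithin_le_nhds (s := Set.Ioi 0))
  refine IsBigO.of_norm_left ((h2.norm_left).congr' ?_ ?_)
  · filter_upwards [Ioo_mem_nhdsGT (one_pos : (0 : ℝ) < 1)] with x hx
    rw [logOneSub, Set.indicator_of_mem hx, Complex.norm_real]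
    simp
  · exact Eventually.of_forall fun x => by simp

lemma betaConst_eq_mellin {a : ℝ} (ha : a < 1) :
    betaConst a = -a * (mellin logOneSub (-(a : ℂ))).re := by
  have hpt : ∀ t ∈ Set.Ioi (0 : ℝ), (t : ℂ) ^ (-(a : ℂ) - 1) • logOneSub t
      = ((Set.indicator (Set.Ioo 0 1) (fun r : ℝ => r ^ (-a - 1) * Real.log (1 - r)) t : ℝ) : ℂ) := by
    intro t ht
    by_cases h : t ∈ Set.Ioo (0 : ℝ) 1
    · rw [logOneSub, Set.indicator_of_mem h, Set.indicator_of_mem h, Complex.ofReal_mul,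
        Complex.ofReal_cpow (le_of_lt ht)]
      simp
    · rw [logOneSub, Set.indicator_of_notMem h, Set.indicator_of_notMem h]
      simp
  have hmel : mellin logOneSub (-(a : ℂ))
      = ((∫ r in (0 : ℝ)..1, r ^ (-a - 1) * Real.log (1 - r) : ℝ) : ℂ) := by
    rw [mellin, MeasureTheory.setIntegral_congr_fun measurableSet_Ioi hpt, integral_complex_ofReal,
      MeasureTheory.setIntegral_indicator measurableSet_Ioo,
      Set.inter_eq_right.2 (fun x hx => hx.1), intervalIntegral.integral_of_le zero_le_one,
      MeasureTheory.integral_Ioc_eq_integral_Ioo]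
  have hint : IntervalIntegrable (fun r : ℝ => r ^ (-a - 1) * Real.log (1 - r))
      MeasureTheory.volume 0 1 := by
    have h := mellinConvergent_of_isBigO_rpow (s := -(a : ℂ)) (a := -a + 1) (b := -1)
      (integrable_logOneSub.locallyIntegrable.locallyIntegrableOn _)
      (logOneSub_isBigO_atTop _) (by simp) logOneSub_isBigO_zero (by simpa using ha)
    have h2 : MeasureTheory.IntegrableOn (Set.indicator (Set.Ioo 0 1)
        (fun r : ℝ => r ^ (-a - 1) * Real.log (1 - r))) (Set.Ioi 0) := by
      have h3 := (MeasureTheory.IntegrableOn.congr_fun h hpt measurableSet_Ioi).re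
      simp only [RCLike.re_to_complex, Complex.ofReal_re] at h3
      exact h3
    rw [intervalIntegrable_iff_integrableOn_Ioo_of_le zero_le_one]
    refine (h2.mono_set (fun x hx => hx.1 : Set.Ioo (0 : ℝ) 1 ⊆ Set.Ioi 0)).congr_fun ?_
      measurableSet_Ioo
    intro x hx
    rw [Set.indicator_of_mem hx]
  have hint' : IntervalIntegrable (fun s : ℝ => a * (1 - s) ^ (-(a + 1)) * Real.log s)
      MeasureTheory.volume 0 1 := by
    have h := ((hint.comp_sub_left 1).symm.const_mul a)
    simp only [sub_zero, sub_self, sub_sub_cancel] at h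
    refine h.congr fun s _ => ?_
    simp only [neg_add, ← sub_eq_add_neg, mul_assoc]
  have hp := intervalIntegrable_one_sub_rpow_sub_one_div ha
  have hsub : ∫ s in (0 : ℝ)..1, a * (1 - s) ^ (-(a + 1)) * Real.log s
      = a * ∫ r in (0 : ℝ)..1, r ^ (-a - 1) * Real.log (1 - r) := by
    have h := intervalIntegral.integral_comp_sub_left
      (fun r : ℝ => r ^ (-a - 1) * Real.log (1 - r)) (a := 0) (b := 1) 1
    simp only [sub_zero, sub_self, sub_sub_cancel] at h
    rw [← h, ← intervalIntegral.integral_const_mul]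
    refine intervalIntegral.integral_congr fun s _ => ?_
    simp only [neg_add, ← sub_eq_add_neg, mul_assoc]
  -- Integrate by parts, with `log` as the antiderivative of `1 / s`.
  have hftc := intervalIntegral.integral_eq_sub_of_hasDerivAt_of_tendsto one_pos
    (f := fun s : ℝ => ((1 - s) ^ (-a) - 1) * Real.log s)
    (f' := fun s : ℝ => a * (1 - s) ^ (-(a + 1)) * Real.log s + ((1 - s) ^ (-a) - 1) / s)
    (fa := 0) (fb := 0) ?_ (hint'.add hp) ?_ ?_
  · rw [intervalIntegral.integral_add hint' hp, hsub] at hftc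
    rw [hmel, Complex.ofReal_re, betaConst]
    linarith
  · intro s hs
    exact ((hasDerivAt_one_sub_rpow hs.2 a).sub_const 1).mul (Real.hasDerivAt_log hs.1.ne')
  · have h1 : (fun s : ℝ => (1 - s) ^ (-a) - 1) =O[𝓝[>] 0] fun s : ℝ => s := by
      simpa [theta] using hasPowerExpansion_one_sub_rpow a 1
    refine (h1.mul (isBigO_refl Real.log _)).trans_tendsto ?_
    have := Real.continuous_mul_log.tendsto 0
    simp only [zero_mul] at this
    exact this.mono_left nhdsWithin_le_nhds
  · have h1 : Real.log =O[𝓝[<] 1] fun s : ℝ => s - 1 := by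
      simpa using (Real.hasDerivAt_log one_ne_zero).isBigO_sub.mono
        (nhdsWithin_le_nhds (s := Set.Iio 1))
    have h2 : Tendsto (fun s : ℝ => (1 - s) ^ (-a) * Real.log s) (𝓝[<] 1) (𝓝 0) := by
      refine ((isBigO_refl (fun s : ℝ => (1 - s) ^ (-a)) _).mul h1).trans_tendsto ?_
      have h3 : Continuous fun s : ℝ => -(1 - s) ^ (1 - a) :=
        (Continuous.rpow_const (by fun_prop) fun s => Or.inr (by linarith)).neg
      have h4 := (h3.tendsto 1).mono_left (nhdsWithin_le_nhds (s := Set.Iio 1))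
      simp only [sub_self, Real.zero_rpow (by linarith : 1 - a ≠ 0), neg_zero] at h4
      refine h4.congr' ?_
      filter_upwards [self_mem_nhdsWithin] with s hs
      have hs' : 0 < 1 - s := sub_pos.2 hs
      rw [sub_eq_add_neg 1 a, Real.rpow_add hs', Real.rpow_one]
      ring
    have h5 : Tendsto Real.log (𝓝[<] 1) (𝓝 0) := by
      simpa using (Real.continuousAt_log one_ne_zero).tendsto.mono_left nhdsWithin_le_nhds
    simpa [sub_mul] using h2.sub h5

lemma analyticOnNhd_betaConst : AnalyticOnNhd ℝ betaConst (Set.Iio 1) := by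
  intro a ha
  have hU : IsOpen {s : ℂ | -1 < s.re} := isOpen_lt continuous_const Complex.continuous_re
  have hd : DifferentiableOn ℂ (mellin logOneSub) {s : ℂ | -1 < s.re} := fun s hs =>
    (mellin_differentiableAt_of_isBigO_rpow (a := s.re + 1) (b := -1)
      (integrable_logOneSub.locallyIntegrable.locallyIntegrableOn _)
      (logOneSub_isBigO_atTop _) (by simp) logOneSub_isBigO_zero hs).differentiableWithinAt
  have hz : AnalyticAt ℂ (mellin logOneSub) (-(a : ℂ)) :=
    hd.analyticAt (hU.mem_nhds (by simpa using ha))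
  have h1 : AnalyticAt ℝ (fun x : ℝ => -(x : ℂ)) a := (Complex.ofRealCLM.analyticAt a).neg
  have h2 : AnalyticAt ℝ (fun x : ℝ => mellin logOneSub (-(x : ℂ))) a :=
    AnalyticAt.comp (g := mellin logOneSub) (hz.restrictScalars (𝕜 := ℝ)) h1
  have h3 : AnalyticAt ℝ (fun x : ℝ => (mellin logOneSub (-(x : ℂ))).re) a :=
    (Complex.reCLM.analyticAt _).comp h2
  refine (analyticAt_id.neg.mul h3).congr ?_
  filter_upwards [Iio_mem_nhds ha] with x hx
  exact (betaConst_eq_mellin hx).symm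

lemma analyticAt_theta (n : ℕ) (a : ℝ) : AnalyticAt ℝ (theta n) a := by
  unfold theta
  exact Finset.analyticAt_fun_prod _ fun j _ => analyticAt_id.add analyticAt_const

lemma analyticOnNhd_betaCoeff (m j : ℕ) : AnalyticOnNhd ℝ (betaCoeff m j) (Set.Iio 1) := by
  induction m generalizing j with
  | zero =>
    rcases j with _ | j
    · exact analyticOnNhd_betaConst
    · intro a _
      change AnalyticAt ℝ
        (fun a => -(theta (j + 1) a / (j + 1).factorial / ((j : ℝ) + 1))) a
      exact (((analyticAt_theta _ a).div_const).div_const).neg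
  | succ m ih =>
    intro a ha
    rcases j with _ | j
    · exact analyticAt_const
    · change AnalyticAt ℝ (fun a => ((m : ℝ) + 1)⁻¹ *
        ((m + a) * betaCoeff m j a + theta (j + 1) (a - 1) / (j + 1).factorial)) a
      have h1 : AnalyticAt ℝ (fun x : ℝ => theta (j + 1) (x - 1)) a :=
        AnalyticAt.fun_comp (g := theta (j + 1)) (f := fun x : ℝ => x - 1)
          (analyticAt_theta (j + 1) (a - 1)) (analyticAt_id.sub analyticAt_const)
      exact analyticAt_const.mul
        (((analyticAt_const.add analyticAt_id).mul (ih j a ha)).add h1.div_const)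

/-! ### Reduction of the heat content to a one-dimensional integral -/

/-- The triangle `0 < u < s ≤ 1` integrated in either order. -/
lemma integral_mul_integral_eq_integral_betaTail {a : ℝ} (ha : a < 1) (m : ℕ) {c : ℝ}
    (hc : 0 ≤ c) :
    ∫ s in Set.Ioc (0 : ℝ) 1, (1 - s) ^ (-a) *
        ∫ y in (0 : ℝ)..1, y ^ m * Real.exp (-(c * (y * s) ^ 2))
      = ∫ u in Set.Ioi (0 : ℝ), Real.exp (-(c * u ^ 2)) * (u ^ m * betaTail m a u) := by
  set F : ℝ → ℝ → ℝ := fun s u => Set.indicator {p : ℝ × ℝ | p.2 < p.1}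
    (fun p => (1 - p.1) ^ (-a) / p.1 ^ (m + 1) * (p.2 ^ m * Real.exp (-(c * p.2 ^ 2)))) (s, u)
    with hF
  have hFmeas : Measurable (Function.uncurry F) := by
    have : Function.uncurry F = Set.indicator {p : ℝ × ℝ | p.2 < p.1}
      (fun p => (1 - p.1) ^ (-a) / p.1 ^ (m + 1) * (p.2 ^ m * Real.exp (-(c * p.2 ^ 2)))) := by
      ext ⟨s, u⟩; rfl
    rw [this]
    exact Measurable.indicator (by fun_prop) (measurableSet_lt measurable_snd measurable_fst)
  have hFs : ∀ s : ℝ, F s = Set.indicator (Set.Iio s) (fun u => (1 - s) ^ (-a) / s ^ (m + 1) *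
      (u ^ m * Real.exp (-(c * u ^ 2)))) := by
    intro s; ext u
    simp [hF, Set.indicator]
  have hcont : Continuous fun u : ℝ => u ^ m * Real.exp (-(c * u ^ 2)) := by fun_prop
  have hinner : ∀ s ∈ Set.Ioc (0 : ℝ) 1, ∫ u in Set.Ioi (0 : ℝ), F s u
      = (1 - s) ^ (-a) * ∫ y in (0 : ℝ)..1, y ^ m * Real.exp (-(c * (y * s) ^ 2)) := by
    intro s hs
    have hs0 : s ≠ 0 := hs.1.ne'
    rw [hFs, MeasureTheory.setIntegral_indicator measurableSet_Iio, Set.Ioi_inter_Iio,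
      ← MeasureTheory.integral_Ioc_eq_integral_Ioo, ← intervalIntegral.integral_of_le hs.1.le,
      intervalIntegral.integral_const_mul]
    have h1 := intervalIntegral.integral_comp_mul_right
      (fun u : ℝ => u ^ m * Real.exp (-(c * u ^ 2))) (a := 0) (b := 1) hs0
    rw [zero_mul, one_mul, smul_eq_mul, eq_inv_mul_iff_mul_eq₀ hs0] at h1
    rw [← h1, ← mul_assoc, ← intervalIntegral.integral_const_mul,
      ← intervalIntegral.integral_const_mul]
    refine intervalIntegral.integral_congr fun y _ => ?_
    simp only [mul_pow]
    field_simp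
    ring
  have hFnonneg : ∀ s ∈ Set.Ioc (0 : ℝ) 1, ∀ u ∈ Set.Ioi (0 : ℝ), 0 ≤ F s u := by
    intro s hs u hu
    rw [hFs]
    refine Set.indicator_apply_nonneg fun _ => ?_
    have h1 : 0 ≤ (1 - s) ^ (-a) := Real.rpow_nonneg (by linarith [hs.2]) _
    have h2 : 0 < s := hs.1
    have h3 : 0 < u := hu
    positivity
  have hint : MeasureTheory.Integrable (Function.uncurry F)
      ((MeasureTheory.volume.restrict (Set.Ioc (0 : ℝ) 1)).prod
        (MeasureTheory.volume.restrict (Set.Ioi (0 : ℝ)))) := by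
    rw [MeasureTheory.integrable_prod_iff hFmeas.aestronglyMeasurable]
    constructor
    · refine (MeasureTheory.ae_restrict_iff' measurableSet_Ioc).2 (Eventually.of_forall ?_)
      intro s hs
      change MeasureTheory.IntegrableOn (F s) (Set.Ioi 0)
      rw [hFs, MeasureTheory.integrableOn_indicator_iff measurableSet_Iio, Set.Iio_inter_Ioi]
      exact ((hcont.const_mul _).integrableOn_Icc).mono_set Set.Ioo_subset_Icc_self
    · refine MeasureTheory.Integrable.mono' (integrableOn_one_sub_rpow ha)
        hFmeas.aestronglyMeasurable.norm.integral_prod_right' ?_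
      refine (MeasureTheory.ae_restrict_iff' measurableSet_Ioc).2 (Eventually.of_forall ?_)
      intro s hs
      have h1 : 0 ≤ (1 - s) ^ (-a) := Real.rpow_nonneg (by linarith [hs.2]) _
      have h2 : ∫ u in Set.Ioi (0 : ℝ), ‖Function.uncurry F (s, u)‖
          = ∫ u in Set.Ioi (0 : ℝ), F s u :=
        MeasureTheory.setIntegral_congr_fun measurableSet_Ioi fun u hu =>
          Real.norm_of_nonneg (hFnonneg s hs u hu)
      rw [h2, hinner s hs]
      have h3 : ‖∫ y in (0 : ℝ)..1, y ^ m * Real.exp (-(c * (y * s) ^ 2))‖ ≤ 1 * |1 - 0| := by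
        refine intervalIntegral.norm_integral_le_of_norm_le_const fun y hy => ?_
        rw [Set.uIoc_of_le zero_le_one] at hy
        rw [norm_mul, Real.norm_of_nonneg (pow_nonneg hy.1.le _),
          Real.norm_of_nonneg (Real.exp_nonneg _)]
        exact mul_le_one₀ (pow_le_one₀ hy.1.le hy.2) (Real.exp_nonneg _)
          (Real.exp_le_one_iff.2 (neg_nonpos.2 (by positivity)))
      rw [norm_mul, Real.norm_of_nonneg h1]
      exact mul_le_of_le_one_right h1 (by simpa using h3)
  rw [← MeasureTheory.setIntegral_congr_fun measurableSet_Ioc hinner,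
    MeasureTheory.integral_integral_swap hint]
  refine MeasureTheory.setIntegral_congr_fun measurableSet_Ioi fun u hu => ?_
  have h1 : ∀ s : ℝ, F s u = Set.indicator (Set.Ioi u) (fun s =>
      Real.exp (-(c * u ^ 2)) * u ^ m * ((1 - s) ^ (-a) / s ^ (m + 1))) s := by
    intro s
    simp only [hF, Set.indicator, Set.mem_ofPred_eq, Set.mem_Ioi]
    split_ifs <;> ring
  simp only [h1]
  rw [MeasureTheory.setIntegral_indicator measurableSet_Ioi, Set.Ioc_inter_Ioi,
    max_eq_right (le_of_lt hu), MeasureTheory.integral_const_mul, betaTail, mul_assoc]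

lemma integrableOn_rpow_neg_Ioc {a : ℝ} (ha : a < 1) :
    MeasureTheory.IntegrableOn (fun x : ℝ => x ^ (-a)) (Set.Ioc 0 1) :=
  (intervalIntegrable_iff_integrableOn_Ioc_of_le zero_le_one).1
    (intervalIntegral.intervalIntegrable_rpow' (by linarith : -1 < -a))

/-- The part of the heat content coming from the triangle `x < y`; the substitution
`x = y * (1 - s)` separates the variables. -/
lemma integral_triangle_eq {a b : ℝ} {m : ℕ} (ha : a < 1) (hab : a + b = 1 - m) {c : ℝ}
    (hc : 0 ≤ c) :
    ∫ y in Set.Ioc (0 : ℝ) 1, ∫ x in (0 : ℝ)..y,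
        Real.exp (-(c * (x - y) ^ 2)) * x ^ (-a) * y ^ (-b)
      = ∫ u in Set.Ioi (0 : ℝ), Real.exp (-(c * u ^ 2)) * (u ^ m * betaTail m a u) := by
  have hinner : ∀ y ∈ Set.Ioc (0 : ℝ) 1, ∫ x in (0 : ℝ)..y,
      Real.exp (-(c * (x - y) ^ 2)) * x ^ (-a) * y ^ (-b)
      = ∫ s in Set.Ioc (0 : ℝ) 1, (1 - s) ^ (-a) * (y ^ m * Real.exp (-(c * (y * s) ^ 2))) := by
    intro y hy
    have h1 := intervalIntegral.integral_comp_sub_mul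
      (fun x : ℝ => Real.exp (-(c * (x - y) ^ 2)) * x ^ (-a) * y ^ (-b)) (a := 0) (b := 1)
      hy.1.ne' y
    rw [mul_one, mul_zero, sub_self, sub_zero, smul_eq_mul, eq_inv_mul_iff_mul_eq₀ hy.1.ne'] at h1
    rw [← h1, ← intervalIntegral.integral_const_mul, intervalIntegral.integral_of_le zero_le_one]
    refine MeasureTheory.setIntegral_congr_fun measurableSet_Ioc fun s hs => ?_
    have h2 : y - y * s = y * (1 - s) := by ring
    have h3 : y ^ m = y * y ^ (-a) * y ^ (-b) := by
      nth_rewrite 2 [← Real.rpow_one y]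
      rw [← Real.rpow_add hy.1, ← Real.rpow_add hy.1, ← Real.rpow_natCast]
      congr 1
      linarith
    simp only [h2]
    rw [Real.mul_rpow hy.1.le (by linarith [hs.2]), h3,
      show (y * (1 - s) - y) ^ 2 = (y * s) ^ 2 by ring]
    ring
  rw [MeasureTheory.setIntegral_congr_fun measurableSet_Ioc hinner,
    MeasureTheory.integral_integral_swap, ← integral_mul_integral_eq_integral_betaTail ha m hc]
  · refine MeasureTheory.setIntegral_congr_fun measurableSet_Ioc fun s _ => ?_
    simp only [MeasureTheory.integral_const_mul]
    rw [intervalIntegral.integral_of_le zero_le_one]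
  · have h1 : MeasureTheory.Integrable (fun p : ℝ × ℝ => (1 : ℝ) * (1 - p.2) ^ (-a))
        ((MeasureTheory.volume.restrict (Set.Ioc (0 : ℝ) 1)).prod
          (MeasureTheory.volume.restrict (Set.Ioc (0 : ℝ) 1))) :=
      (MeasureTheory.integrable_const (1 : ℝ)).mul_prod (integrableOn_one_sub_rpow ha)
    refine h1.mono (by
      exact Measurable.aestronglyMeasurable (by unfold Function.uncurry; fun_prop)) ?_
    rw [MeasureTheory.Measure.prod_restrict]
    refine (MeasureTheory.ae_restrict_iff' (measurableSet_Ioc.prod measurableSet_Ioc)).2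
      (Eventually.of_forall ?_)
    rintro ⟨y, s⟩ ⟨hy, -⟩
    simp only [Function.uncurry, one_mul, norm_mul]
    refine mul_le_of_le_one_right (norm_nonneg _) ?_
    rw [Real.norm_of_nonneg (pow_nonneg hy.1.le _), Real.norm_of_nonneg (Real.exp_nonneg _)]
    exact mul_le_one₀ (pow_le_one₀ hy.1.le hy.2) (Real.exp_nonneg _)
      (Real.exp_le_one_iff.2 (neg_nonpos.2 (by positivity)))

lemma integrable_gaussian_mul_rpow {a b : ℝ} (ha : a < 1) (hb : b < 1) {c : ℝ} (hc : 0 ≤ c) :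
    MeasureTheory.Integrable
      (fun p : ℝ × ℝ => Real.exp (-(c * (p.2 - p.1) ^ 2)) * p.2 ^ (-a) * p.1 ^ (-b))
      ((MeasureTheory.volume.restrict (Set.Ioc (0 : ℝ) 1)).prod
        (MeasureTheory.volume.restrict (Set.Ioc (0 : ℝ) 1))) := by
  refine ((integrableOn_rpow_neg_Ioc hb).mul_prod (integrableOn_rpow_neg_Ioc ha)).mono
    (Measurable.aestronglyMeasurable (by fun_prop)) (Eventually.of_forall ?_)
  rintro ⟨y, x⟩
  simp only [norm_mul]
  rw [mul_assoc, mul_comm ‖y ^ (-b)‖]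
  refine mul_le_of_le_one_left (by positivity) ?_
  rw [Real.norm_of_nonneg (Real.exp_nonneg _)]
  exact Real.exp_le_one_iff.2 (neg_nonpos.2 (by positivity))

/-- The unit square is cut along its diagonal; the reflection `(x, y) ↦ (y, x)` maps one of the
two triangles to the other and exchanges the two exponents. -/
lemma integral_square_eq {a b : ℝ} (ha : a < 1) (hb : b < 1) {c : ℝ} (hc : 0 ≤ c) :
    ∫ y in (0 : ℝ)..1, ∫ x in (0 : ℝ)..1, Real.exp (-(c * (x - y) ^ 2)) * x ^ (-a) * y ^ (-b)
      = (∫ y in Set.Ioc (0 : ℝ) 1, ∫ x in (0 : ℝ)..y,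
          Real.exp (-(c * (x - y) ^ 2)) * x ^ (-a) * y ^ (-b))
      + ∫ y in Set.Ioc (0 : ℝ) 1, ∫ x in (0 : ℝ)..y,
          Real.exp (-(c * (x - y) ^ 2)) * x ^ (-b) * y ^ (-a) := by
  set μ := MeasureTheory.volume.restrict (Set.Ioc (0 : ℝ) 1) with hμ
  set K : ℝ × ℝ → ℝ := fun p => Real.exp (-(c * (p.2 - p.1) ^ 2)) * p.2 ^ (-a) * p.1 ^ (-b) with hK
  have hint : MeasureTheory.Integrable K (μ.prod μ) := integrable_gaussian_mul_rpow ha hb hc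
  have hD : MeasurableSet {p : ℝ × ℝ | p.2 ≤ p.1} := measurableSet_le measurable_snd measurable_fst
  have h0 : ∫ y in (0 : ℝ)..1, ∫ x in (0 : ℝ)..1,
      Real.exp (-(c * (x - y) ^ 2)) * x ^ (-a) * y ^ (-b) = ∫ p, K p ∂(μ.prod μ) := by
    rw [MeasureTheory.integral_prod K hint]
    simp only [intervalIntegral.integral_of_le zero_le_one, hK, hμ]
  rw [h0, ← MeasureTheory.integral_add_compl hD hint]
  congr 1
  · rw [← MeasureTheory.integral_indicator hD,
      MeasureTheory.integral_prod _ (hint.indicator hD)]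
    refine MeasureTheory.setIntegral_congr_fun measurableSet_Ioc fun y hy => ?_
    have h1 : ∀ x : ℝ, Set.indicator {p : ℝ × ℝ | p.2 ≤ p.1} K (y, x)
        = Set.indicator (Set.Iic y) (fun x => K (y, x)) x := by
      intro x; simp [Set.indicator]
    simp only [h1]
    rw [hμ, MeasureTheory.setIntegral_indicator measurableSet_Iic, Set.Ioc_inter_Iic,
      min_eq_right hy.2, ← intervalIntegral.integral_of_le hy.1.le]
  · rw [← MeasureTheory.integral_indicator hD.compl,
      MeasureTheory.integral_prod_symm _ (hint.indicator hD.compl)]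
    refine MeasureTheory.setIntegral_congr_fun measurableSet_Ioc fun x hx => ?_
    have h1 : ∀ y : ℝ, Set.indicator {p : ℝ × ℝ | p.2 ≤ p.1}ᶜ K (y, x)
        = Set.indicator (Set.Iio x) (fun y => K (y, x)) y := by
      intro y; simp [Set.indicator]
    have h2 : Set.Ioc (0 : ℝ) 1 ∩ Set.Iio x = Set.Ioo 0 x := by
      ext y
      simp only [Set.mem_inter_iff, Set.mem_Ioc, Set.mem_Iio, Set.mem_Ioo]
      exact ⟨fun h => ⟨h.1.1, h.2⟩, fun h => ⟨⟨h.1, h.2.le.trans hx.2⟩, h.2⟩⟩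
    simp only [h1]
    rw [hμ, MeasureTheory.setIntegral_indicator measurableSet_Iio, h2,
      ← MeasureTheory.integral_Ioc_eq_integral_Ioo, ← intervalIntegral.integral_of_le hx.1.le]
    refine intervalIntegral.integral_congr fun y _ => ?_
    simp only [hK]
    rw [show (x - y) ^ 2 = (y - x) ^ 2 by ring]
    ring

lemma intervalHeatContent_eq {a b : ℝ} {m : ℕ} (ha : a < 1) (hb : b < 1) (hab : a + b = 1 - m)
    {t : ℝ} (ht : 0 < t) :
    intervalHeatContent a b t = (Real.sqrt Real.pi)⁻¹ *
      ((∫ v in Set.Ioi (0 : ℝ), Real.exp (-v ^ 2) *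
          ((2 * √t * v) ^ m * betaTail m a (2 * √t * v)))
        + ∫ v in Set.Ioi (0 : ℝ), Real.exp (-v ^ 2) *
          ((2 * √t * v) ^ m * betaTail m b (2 * √t * v))) := by
  have hst : 0 < √t := Real.sqrt_pos.2 ht
  have hsq : √t ^ 2 = t := Real.sq_sqrt ht.le
  have hpi : 0 < √Real.pi := Real.sqrt_pos.2 Real.pi_pos
  have hs4 : √(4 * Real.pi * t) = 2 * √Real.pi * √t := by
    rw [Real.sqrt_mul (by positivity), Real.sqrt_mul (by positivity),
      show (4 : ℝ) = 2 ^ 2 by norm_num, Real.sqrt_sq (by norm_num)]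
  have hc : 0 ≤ (4 * t)⁻¹ := by positivity
  have hscale : ∀ d : ℝ, ∫ v in Set.Ioi (0 : ℝ), Real.exp (-v ^ 2) *
        ((2 * √t * v) ^ m * betaTail m d (2 * √t * v))
      = (2 * √t)⁻¹ * ∫ u in Set.Ioi (0 : ℝ), Real.exp (-((4 * t)⁻¹ * u ^ 2)) *
        (u ^ m * betaTail m d u) := by
    intro d
    have h := MeasureTheory.integral_comp_mul_left_Ioi (fun u : ℝ =>
      Real.exp (-((4 * t)⁻¹ * u ^ 2)) * (u ^ m * betaTail m d u)) 0
      (by positivity : 0 < 2 * √t)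
    rw [mul_zero, smul_eq_mul] at h
    rw [← h]
    congr 1
    ext v
    congr 3
    rw [mul_pow, mul_pow, hsq]
    field_simp
    norm_num
  have hk : ∀ x y : ℝ, heatKernel x y t * x ^ (-a) * y ^ (-b)
      = (2 * √Real.pi * √t)⁻¹ *
        (Real.exp (-((4 * t)⁻¹ * (x - y) ^ 2)) * x ^ (-a) * y ^ (-b)) := by
    intro x y
    rw [heatKernel, hs4, show -(x - y) ^ 2 / (4 * t) = -((4 * t)⁻¹ * (x - y) ^ 2) by ring]
    ring
  rw [hscale, hscale, intervalHeatContent, heatContent]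
  simp only [hk, intervalIntegral.integral_const_mul]
  rw [integral_square_eq ha hb hc, integral_triangle_eq ha hab hc,
    integral_triangle_eq hb (by rw [add_comm, hab]) hc, mul_inv, mul_inv, mul_inv]
  ring

/-! ### Gaussian averages -/

lemma integrableOn_gaussian_mul_rpow {r : ℝ} (hr : -1 < r) :
    MeasureTheory.IntegrableOn (fun v : ℝ => Real.exp (-v ^ 2) * v ^ r) (Set.Ioi 0) := by
  refine (integrableOn_rpow_mul_exp_neg_mul_sq one_pos hr).congr_fun (fun v _ => ?_)
    measurableSet_Ioi
  beta_reduce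
  rw [neg_one_mul, mul_comm]

lemma integrableOn_gaussian_mul_pow (n : ℕ) :
    MeasureTheory.IntegrableOn (fun v : ℝ => Real.exp (-v ^ 2) * v ^ n) (Set.Ioi 0) := by
  simpa using integrableOn_gaussian_mul_rpow (r := n) (by linarith [n.cast_nonneg (α := ℝ)])

lemma integrableOn_gaussian_mul_pow_mul_log (n : ℕ) :
    MeasureTheory.IntegrableOn (fun v : ℝ => Real.exp (-v ^ 2) * (v ^ n * Real.log v))
      (Set.Ioi 0) := by
  have hn := n.cast_nonneg (α := ℝ)
  refine MeasureTheory.Integrable.mono'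
    (g := fun v => Real.exp (-v ^ 2) * v ^ (n + 1) + 2 * (Real.exp (-v ^ 2) * v ^ ((n : ℝ) - 1 / 2)))
    ((integrableOn_gaussian_mul_pow (n + 1)).add
      ((integrableOn_gaussian_mul_rpow (by linarith)).const_mul 2))
    (Measurable.aestronglyMeasurable (by fun_prop)) ?_
  refine (MeasureTheory.ae_restrict_iff' measurableSet_Ioi).2 (Eventually.of_forall ?_)
  intro v (hv : 0 < v)
  have hlog : |Real.log v| ≤ v + 2 * v ^ (-(1 / 2) : ℝ) := by
    have hp : 0 < v ^ (-(1 / 2) : ℝ) := Real.rpow_pos_of_pos hv _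
    rcases le_total v 1 with h | h
    · have h1 := (Real.abs_log_mul_self_rpow_lt v (1 / 2) hv h (by norm_num)).le
      rw [abs_mul, abs_of_pos (Real.rpow_pos_of_pos hv _)] at h1
      have h2 := mul_le_mul_of_nonneg_right h1 hp.le
      rw [mul_assoc, ← Real.rpow_add hv] at h2
      norm_num at h2 ⊢
      linarith
    · rw [abs_of_nonneg (Real.log_nonneg h)]
      linarith [Real.log_le_self hv.le]
  rw [norm_mul, norm_mul, Real.norm_of_nonneg (Real.exp_nonneg _),
    Real.norm_of_nonneg (pow_nonneg hv.le _), Real.norm_eq_abs]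
  have h3 : v ^ ((n : ℝ) - 1 / 2) = v ^ n * v ^ (-(1 / 2) : ℝ) := by
    rw [sub_eq_add_neg, Real.rpow_add hv, Real.rpow_natCast]
  calc Real.exp (-v ^ 2) * (v ^ n * |Real.log v|)
      ≤ Real.exp (-v ^ 2) * (v ^ n * (v + 2 * v ^ (-(1 / 2) : ℝ))) := by gcongr
    _ = _ := by rw [h3]; ring

/-- The half-line Gaussian moment of order `n`. -/
noncomputable def gaussMoment (n : ℕ) : ℝ :=
  ∫ v in Set.Ioi (0 : ℝ), Real.exp (-v ^ 2) * v ^ n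

/-- The half-line Gaussian moment of order `n`, weighted by the logarithm. -/
noncomputable def gaussLogMoment (n : ℕ) : ℝ :=
  ∫ v in Set.Ioi (0 : ℝ), Real.exp (-v ^ 2) * (v ^ n * Real.log v)

lemma gamma_natCast_add_half_mul (k : ℕ) :
    Real.Gamma (k + 1 / 2) * (2 ^ (2 * k) * k.factorial) = √Real.pi * (2 * k).factorial := by
  induction k with
  | zero => simp [-one_div, Real.Gamma_one_half_eq]
  | succ k ih =>
    rw [show ((k + 1 : ℕ) : ℝ) + 1 / 2 = (k + 1 / 2 : ℝ) + 1 by push_cast; ring,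
      Real.Gamma_add_one (by positivity), show 2 * (k + 1) = 2 * k + 1 + 1 by ring,
      Nat.factorial_succ (2 * k + 1), Nat.factorial_succ (2 * k), Nat.factorial_succ k]
    push_cast
    linear_combination (4 * (k + 1 / 2) * ((k : ℝ) + 1)) * ih

lemma gaussMoment_two_mul (k : ℕ) :
    gaussMoment (2 * k) * (2 * (2 ^ (2 * k) * k.factorial)) = √Real.pi * (2 * k).factorial := by
  have h := integral_rpow_mul_exp_neg_rpow (p := 2) (q := (2 * k : ℕ)) two_pos
    (by linarith [(2 * k).cast_nonneg (α := ℝ)])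
  have h2 : gaussMoment (2 * k) = 1 / 2 * Real.Gamma (k + 1 / 2) := by
    rw [show (k : ℝ) + 1 / 2 = (((2 * k : ℕ) : ℝ) + 1) / 2 by push_cast; ring, ← h, gaussMoment]
    refine MeasureTheory.setIntegral_congr_fun measurableSet_Ioi fun v _ => ?_
    simp only [Real.rpow_natCast, Real.rpow_two, mul_comm]
  rw [h2, ← gamma_natCast_add_half_mul]
  ring

/-- A continuous function on the half-line that is `O(u ^ N)` at both ends is bounded by a multiple
of `u ^ N` throughout. -/
lemma exists_bound_of_isBigO_ends {R : ℝ → ℝ} {N : ℕ} (hR : ContinuousOn R (Set.Ioi 0))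
    (h0 : R =O[𝓝[>] 0] fun u : ℝ => u ^ N) (h1 : R =O[atTop] fun u : ℝ => u ^ N) :
    ∃ C, ∀ u : ℝ, 0 < u → |R u| ≤ C * u ^ N := by
  obtain ⟨C₀, hC₀⟩ := h0.bound
  obtain ⟨δ, hδ, hδC⟩ := mem_nhdsGT_iff_exists_Ioo_subset.1 hC₀
  obtain ⟨C₁, hC₁⟩ := h1.bound
  obtain ⟨T, hT⟩ := eventually_atTop.1 hC₁
  obtain ⟨C₂, hC₂⟩ := (isCompact_Icc (a := δ) (b := T)).exists_bound_of_continuousOn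
    (f := fun u => R u / u ^ N)
    ((hR.mono fun u hu => lt_of_lt_of_le hδ hu.1).div (by fun_prop)
      fun u hu => pow_ne_zero _ (lt_of_lt_of_le hδ hu.1).ne')
  refine ⟨max C₀ (max C₁ C₂), fun u hu => ?_⟩
  have hpos : 0 < u ^ N := pow_pos hu N
  have hn : ‖u ^ N‖ = u ^ N := Real.norm_of_nonneg hpos.le
  rcases lt_or_ge u δ with h | h
  · have h2 : ‖R u‖ ≤ C₀ * ‖u ^ N‖ := hδC ⟨hu, h⟩
    rw [hn] at h2
    exact h2.trans (mul_le_mul_of_nonneg_right (le_max_left _ _) hpos.le)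
  rcases le_total u T with h' | h'
  · have h2 := hC₂ u ⟨h, h'⟩
    rw [norm_div, hn, div_le_iff₀ hpos] at h2
    exact h2.trans (mul_le_mul_of_nonneg_right
      ((le_max_right _ _).trans (le_max_right _ _)) hpos.le)
  · have h2 := hT u h'
    rw [hn] at h2
    exact h2.trans (mul_le_mul_of_nonneg_right
      ((le_max_left _ _).trans (le_max_right _ _)) hpos.le)

lemma isBigO_pow_atTop {j N : ℕ} (h : j ≤ N) :
    (fun u : ℝ => u ^ j) =O[atTop] fun u : ℝ => u ^ N := by
  refine IsBigO.of_bound 1 ?_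
  filter_upwards [eventually_ge_atTop 1] with u hu
  rw [one_mul, norm_pow, norm_pow, Real.norm_of_nonneg (by linarith)]
  exact pow_le_pow_right₀ hu h

/-- The remainder of the expansion of `u ^ m * betaTail m a u` is controlled on the whole half-line.
For `u ≥ 1`, where `betaTail` vanishes, the truncated expansion itself is `O(u ^ N)`. -/
lemma exists_bound_betaTail_remainder {a : ℝ} (ha : a < 1) {m N : ℕ} (hN : m + 1 ≤ N) :
    ∃ C, ∀ u : ℝ, 0 < u → |u ^ m * betaTail m a u + theta m a / m.factorial * (u ^ m * Real.log u)
      - ∑ j ∈ Finset.range N, betaCoeff m j a * u ^ j| ≤ C * u ^ N := by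
  refine exists_bound_of_isBigO_ends ?_ (hasPowerExpansion_betaTail ha m N) ?_
  · have h1 := continuousOn_betaTail ha m
    have h2 : ContinuousOn Real.log (Set.Ioi 0) :=
      Real.continuousOn_log.mono fun u hu => (ne_of_gt hu : u ≠ 0)
    fun_prop
  · have hV : (fun u : ℝ => u ^ m * betaTail m a u) =O[atTop] fun u : ℝ => u ^ N := by
      refine (isBigO_zero _ _).congr' ?_ EventuallyEq.rfl
      filter_upwards [eventually_ge_atTop 1] with u hu
      simp [betaTail, Set.Ioc_eq_empty (not_lt.2 hu)]
    have hlog : (fun u : ℝ => u ^ m * Real.log u) =O[atTop] fun u : ℝ => u ^ N :=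
      ((isBigO_refl (fun u : ℝ => u ^ m) _).mul
        Real.isLittleO_log_id_atTop.isBigO).trans (isBigO_pow_atTop hN)
    exact (hV.add (hlog.const_mul_left _)).sub (IsBigO.fun_sum fun j hj =>
      (isBigO_pow_atTop (Finset.mem_range.1 hj).le).const_mul_left _)

/-- Watson's lemma for the Gaussian averages of `u ^ m * betaTail m a u`. -/
lemma exists_bound_integral_betaTail {a : ℝ} (ha : a < 1) {m N : ℕ} (hN : m + 1 ≤ N) :
    ∃ C, ∀ ε : ℝ, 0 < ε →
      |(∫ v in Set.Ioi (0 : ℝ), Real.exp (-v ^ 2) * ((ε * v) ^ m * betaTail m a (ε * v)))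
        - ((∑ j ∈ Finset.range N, betaCoeff m j a * gaussMoment j * ε ^ j)
          - theta m a / m.factorial * ε ^ m *
            (Real.log ε * gaussMoment m + gaussLogMoment m))| ≤ C * ε ^ N := by
  obtain ⟨C, hC⟩ := exists_bound_betaTail_remainder ha hN
  refine ⟨C * gaussMoment N, fun ε hε => ?_⟩
  set R : ℝ → ℝ := fun v => Real.exp (-v ^ 2) * ((ε * v) ^ m * betaTail m a (ε * v)
    + theta m a / m.factorial * ((ε * v) ^ m * Real.log (ε * v))
    - ∑ j ∈ Finset.range N, betaCoeff m j a * (ε * v) ^ j) with hR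
  have hmaps : Set.MapsTo (fun v : ℝ => ε * v) (Set.Ioi 0) (Set.Ioi 0) := fun v hv => mul_pos hε hv
  have hRcont : ContinuousOn R (Set.Ioi 0) := by
    have h1 : ContinuousOn (fun v => betaTail m a (ε * v)) (Set.Ioi 0) :=
      (continuousOn_betaTail ha m).comp (by fun_prop) hmaps
    have h2 : ContinuousOn (fun v => Real.log (ε * v)) (Set.Ioi 0) :=
      Real.continuousOn_log.comp (by fun_prop) fun v hv => (mul_pos hε hv).ne'
    fun_prop
  have hRbound : ∀ v ∈ Set.Ioi (0 : ℝ), ‖R v‖ ≤ C * ε ^ N * (Real.exp (-v ^ 2) * v ^ N) := by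
    intro v hv
    rw [hR, norm_mul, Real.norm_of_nonneg (Real.exp_nonneg _)]
    refine (mul_le_mul_of_nonneg_left (hC _ (hmaps hv)) (Real.exp_nonneg _)).trans_eq ?_
    rw [mul_pow]
    ring
  have hg := (integrableOn_gaussian_mul_pow N).const_mul (C * ε ^ N)
  have hRint : MeasureTheory.IntegrableOn R (Set.Ioi 0) :=
    MeasureTheory.Integrable.mono' hg (hRcont.aestronglyMeasurable measurableSet_Ioi)
      ((MeasureTheory.ae_restrict_iff' measurableSet_Ioi).2 (Eventually.of_forall hRbound))
  have hsumint : MeasureTheory.IntegrableOn (fun v : ℝ => ∑ j ∈ Finset.range N,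
      betaCoeff m j a * ε ^ j * (Real.exp (-v ^ 2) * v ^ j)) (Set.Ioi 0) :=
    MeasureTheory.integrable_finsetSum _ fun j _ =>
      (integrableOn_gaussian_mul_pow j).const_mul _
  have hlogint : MeasureTheory.IntegrableOn (fun v : ℝ => theta m a / m.factorial * ε ^ m *
      (Real.log ε * (Real.exp (-v ^ 2) * v ^ m) + Real.exp (-v ^ 2) * (v ^ m * Real.log v)))
      (Set.Ioi 0) :=
    (((integrableOn_gaussian_mul_pow m).const_mul _).add
      (integrableOn_gaussian_mul_pow_mul_log m)).const_mul _
  have hdiffint : MeasureTheory.IntegrableOn (fun v : ℝ =>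
      (∑ j ∈ Finset.range N, betaCoeff m j a * ε ^ j * (Real.exp (-v ^ 2) * v ^ j))
        - theta m a / m.factorial * ε ^ m * (Real.log ε * (Real.exp (-v ^ 2) * v ^ m)
          + Real.exp (-v ^ 2) * (v ^ m * Real.log v))) (Set.Ioi 0) :=
    hsumint.sub hlogint
  have hsplit : ∀ v ∈ Set.Ioi (0 : ℝ), Real.exp (-v ^ 2) * ((ε * v) ^ m * betaTail m a (ε * v))
      = R v + ((∑ j ∈ Finset.range N, betaCoeff m j a * ε ^ j * (Real.exp (-v ^ 2) * v ^ j))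
        - theta m a / m.factorial * ε ^ m * (Real.log ε * (Real.exp (-v ^ 2) * v ^ m)
          + Real.exp (-v ^ 2) * (v ^ m * Real.log v))) := by
    intro v hv
    have h1 : ∑ j ∈ Finset.range N, betaCoeff m j a * ε ^ j * (Real.exp (-v ^ 2) * v ^ j)
        = Real.exp (-v ^ 2) * ∑ j ∈ Finset.range N, betaCoeff m j a * (ε * v) ^ j := by
      rw [Finset.mul_sum]
      exact Finset.sum_congr rfl fun j _ => by rw [mul_pow]; ring
    simp only [hR]
    rw [h1, Real.log_mul hε.ne' (ne_of_gt hv), mul_pow]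
    ring
  have hval : ∫ v in Set.Ioi (0 : ℝ), Real.exp (-v ^ 2) * ((ε * v) ^ m * betaTail m a (ε * v))
      = (∫ v in Set.Ioi (0 : ℝ), R v)
        + ((∑ j ∈ Finset.range N, betaCoeff m j a * gaussMoment j * ε ^ j)
          - theta m a / m.factorial * ε ^ m *
            (Real.log ε * gaussMoment m + gaussLogMoment m)) := by
    rw [MeasureTheory.setIntegral_congr_fun measurableSet_Ioi hsplit,
      MeasureTheory.integral_add hRint hdiffint,
      MeasureTheory.integral_sub hsumint hlogint, MeasureTheory.integral_const_mul,
      MeasureTheory.integral_add ((integrableOn_gaussian_mul_pow m).const_mul _)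
        (integrableOn_gaussian_mul_pow_mul_log m), MeasureTheory.integral_const_mul,
      MeasureTheory.integral_finsetSum _ fun j _ =>
        (integrableOn_gaussian_mul_pow j).const_mul _]
    congr 2
    refine Finset.sum_congr rfl fun j _ => ?_
    rw [MeasureTheory.integral_const_mul, gaussMoment]
    ring
  rw [hval, add_sub_cancel_right]
  refine (MeasureTheory.norm_integral_le_of_norm_le hg
    ((MeasureTheory.ae_restrict_iff' measurableSet_Ioi).2 (Eventually.of_forall hRbound))).trans_eq ?_
  rw [MeasureTheory.integral_const_mul, gaussMoment]
  ring

/-! ### The expansion of the heat content -/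

lemma theta_two_mul_reflect {a b : ℝ} {k : ℕ} (hab : a + b = 1 - 2 * (k : ℝ)) :
    theta (2 * k) b = theta (2 * k) a := by
  unfold theta
  rw [← Finset.prod_range_reflect fun j : ℕ => a + (j : ℝ)]
  have h : ∀ j ∈ Finset.range (2 * k), b + (j : ℝ) = -1 * (a + ((2 * k - 1 - j : ℕ) : ℝ)) := by
    intro j hj
    have hj' := Finset.mem_range.1 hj
    rw [Nat.cast_sub (by omega), Nat.cast_sub (by omega)]
    push_cast
    linarith
  rw [Finset.prod_congr rfl h, Finset.prod_mul_distrib]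
  simp

/-- The coefficient of `t ^ (n / 2)` on the segment `a + b = 1 - 2 * k`, as a function analytic for
`a < 1`, `b < 1`. For `n = 2 * k` it includes the non-logarithmic part of the term
`u ^ (2 * k) * log u`. -/
noncomputable def heatCoeff (k n : ℕ) (p : ℝ × ℝ) : ℝ :=
  (√Real.pi)⁻¹ * 2 ^ n * (gaussMoment n * (betaCoeff (2 * k) n p.1 + betaCoeff (2 * k) n p.2)
    - if n = 2 * k then (theta (2 * k) p.1 + theta (2 * k) p.2) / (2 * k).factorial *
        (Real.log 2 * gaussMoment (2 * k) + gaussLogMoment (2 * k)) else 0)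

lemma analyticAt_heatCoeff (k n : ℕ) {p : ℝ × ℝ} (h1 : p.1 < 1) (h2 : p.2 < 1) :
    AnalyticAt ℝ (heatCoeff k n) p := by
  have hb1 : AnalyticAt ℝ (fun q : ℝ × ℝ => betaCoeff (2 * k) n q.1) p :=
    AnalyticAt.fun_comp (g := betaCoeff (2 * k) n) (f := Prod.fst)
      (analyticOnNhd_betaCoeff _ _ _ h1) analyticAt_fst
  have hb2 : AnalyticAt ℝ (fun q : ℝ × ℝ => betaCoeff (2 * k) n q.2) p :=
    AnalyticAt.fun_comp (g := betaCoeff (2 * k) n) (f := Prod.snd)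
      (analyticOnNhd_betaCoeff _ _ _ h2) analyticAt_snd
  have ht1 : AnalyticAt ℝ (fun q : ℝ × ℝ => theta (2 * k) q.1) p :=
    AnalyticAt.fun_comp (g := theta (2 * k)) (f := Prod.fst) (analyticAt_theta _ _) analyticAt_fst
  have ht2 : AnalyticAt ℝ (fun q : ℝ × ℝ => theta (2 * k) q.2) p :=
    AnalyticAt.fun_comp (g := theta (2 * k)) (f := Prod.snd) (analyticAt_theta _ _) analyticAt_snd
  unfold heatCoeff
  refine analyticAt_const.mul ((analyticAt_const.mul (hb1.add hb2)).sub ?_)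
  split_ifs
  · exact ((ht1.add ht2).div_const).mul analyticAt_const
  · exact analyticAt_const

/-- The index of the segment `p.1 + p.2 = 1 - 2 * k` nearest to `p`; it is locally constant near
these segments. -/
noncomputable def segmentIndex (p : ℝ × ℝ) : ℕ :=
  ⌊(1 - p.1 - p.2) / 2 + 1 / 2⌋₊

lemma segmentIndex_eq {p : ℝ × ℝ} {k : ℕ} (h : |p.1 + p.2 - (1 - 2 * (k : ℝ))| < 1) :
    segmentIndex p = k := by
  rw [abs_lt] at h
  have hk := k.cast_nonneg (α := ℝ)
  rw [segmentIndex, Nat.floor_eq_iff (by linarith [h.2])]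
  constructor <;> linarith [h.1, h.2]

theorem theorem3p2 :
    ∃ c : ℕ → ℝ × ℝ → ℝ,
      (∀ n : ℕ, AnalyticOnNhd ℝ (c n)
        {p : ℝ × ℝ | p.1 < 1 ∧ p.2 < 1 ∧ ∃ k : ℕ, p.1 + p.2 = 1 - 2 * (k : ℝ)}) ∧
      ∀ (a b : ℝ) (k : ℕ), a < 1 → b < 1 → a + b = 1 - 2 * (k : ℝ) →
        ∀ N : ℕ, 2 * k + 1 ≤ N →
          (fun t : ℝ => intervalHeatContent a b t -
              ((∑ n ∈ Finset.range (N + 1), c n (a, b) * t ^ ((n : ℝ) / 2)) -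
                theta (2 * k) a / (2 * (k.factorial : ℝ)) * t ^ k * Real.log t))
            =O[𝓝[>] (0 : ℝ)] fun t : ℝ => t ^ (((N : ℝ) + 1) / 2) := by
  refine ⟨fun n p => heatCoeff (segmentIndex p) n p, ?_, ?_⟩
  · rintro n p ⟨h1, h2, k, hk⟩
    refine (analyticAt_heatCoeff k n h1 h2).congr ?_
    have hcont : Continuous fun q : ℝ × ℝ => |q.1 + q.2 - (1 - 2 * (k : ℝ))| := by fun_prop
    have hp : |p.1 + p.2 - (1 - 2 * (k : ℝ))| < 1 := by simp [hk]
    filter_upwards [hcont.continuousAt.eventually_lt continuousAt_const hp] with q hq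
    rw [segmentIndex_eq hq]
  · intro a b k ha hb hab N hN
    have hk : segmentIndex (a, b) = k := segmentIndex_eq (by simp [hab])
    have hab' : a + b = 1 - ((2 * k : ℕ) : ℝ) := by push_cast; exact hab
    obtain ⟨Ca, hCa⟩ := exists_bound_integral_betaTail ha (by omega : 2 * k + 1 ≤ N + 1)
    obtain ⟨Cb, hCb⟩ := exists_bound_integral_betaTail hb (by omega : 2 * k + 1 ≤ N + 1)
    refine IsBigO.of_bound ((√Real.pi)⁻¹ * (Ca + Cb) * 2 ^ (N + 1)) ?_
    filter_upwards [self_mem_nhdsWithin] with t (ht : 0 < t)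
    have hst : 0 < √t := Real.sqrt_pos.2 ht
    have hpi : 0 < √Real.pi := Real.sqrt_pos.2 Real.pi_pos
    have hpow : ∀ n : ℕ, t ^ ((n : ℝ) / 2) = √t ^ n := fun n => by
      rw [Real.rpow_div_two_eq_sqrt _ ht.le, Real.rpow_natCast]
    have hA := hCa (2 * √t) (by positivity)
    have hB := hCb (2 * √t) (by positivity)
    rw [intervalHeatContent_eq ha hb hab' ht]
    set Ia := ∫ v in Set.Ioi (0 : ℝ), Real.exp (-v ^ 2) *
      ((2 * √t * v) ^ (2 * k) * betaTail (2 * k) a (2 * √t * v))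
    set Ib := ∫ v in Set.Ioi (0 : ℝ), Real.exp (-v ^ 2) *
      ((2 * √t * v) ^ (2 * k) * betaTail (2 * k) b (2 * √t * v))
    have hlog : Real.log (2 * √t) = Real.log 2 + Real.log t / 2 := by
      rw [Real.log_mul two_ne_zero hst.ne', Real.log_sqrt ht.le]
    have hsum : ∑ n ∈ Finset.range (N + 1), heatCoeff k n (a, b) * t ^ ((n : ℝ) / 2)
        = (√Real.pi)⁻¹ * ((∑ j ∈ Finset.range (N + 1), betaCoeff (2 * k) j a * gaussMoment j *
              (2 * √t) ^ j)
            + (∑ j ∈ Finset.range (N + 1), betaCoeff (2 * k) j b * gaussMoment j * (2 * √t) ^ j)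
            - (theta (2 * k) a + theta (2 * k) b) / (2 * k).factorial *
              (Real.log 2 * gaussMoment (2 * k) + gaussLogMoment (2 * k)) *
              (2 * √t) ^ (2 * k)) := by
      have h1 : (theta (2 * k) a + theta (2 * k) b) / (2 * k).factorial *
          (Real.log 2 * gaussMoment (2 * k) + gaussLogMoment (2 * k)) * (2 * √t) ^ (2 * k)
          = ∑ j ∈ Finset.range (N + 1), if j = 2 * k then
            (theta (2 * k) a + theta (2 * k) b) / (2 * k).factorial *
            (Real.log 2 * gaussMoment (2 * k) + gaussLogMoment (2 * k)) * (2 * √t) ^ j else 0 := by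
        rw [Finset.sum_ite_eq', if_pos (Finset.mem_range.2 (by omega))]
      rw [h1, ← Finset.sum_add_distrib, ← Finset.sum_sub_distrib, Finset.mul_sum]
      refine Finset.sum_congr rfl fun j _ => ?_
      rw [heatCoeff, hpow, mul_pow]
      split_ifs <;> ring
    have hcoef : (√Real.pi)⁻¹ * (theta (2 * k) a / (2 * k).factorial) * 2 ^ (2 * k) *
        gaussMoment (2 * k) = theta (2 * k) a / (2 * k.factorial) := by
      have h1 := gaussMoment_two_mul k
      field_simp
      linear_combination theta (2 * k) a * h1
    have htk : t ^ k = √t ^ (2 * k) := by rw [pow_mul, Real.sq_sqrt ht.le]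
    have hmain : (√Real.pi)⁻¹ * (Ia + Ib) -
        ((∑ n ∈ Finset.range (N + 1), heatCoeff k n (a, b) * t ^ ((n : ℝ) / 2)) -
          theta (2 * k) a / (2 * (k.factorial : ℝ)) * t ^ k * Real.log t)
        = (√Real.pi)⁻¹ * ((Ia - ((∑ j ∈ Finset.range (N + 1),
              betaCoeff (2 * k) j a * gaussMoment j * (2 * √t) ^ j)
            - theta (2 * k) a / (2 * k).factorial * (2 * √t) ^ (2 * k) *
              (Real.log (2 * √t) * gaussMoment (2 * k) + gaussLogMoment (2 * k))))
          + (Ib - ((∑ j ∈ Finset.range (N + 1),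
              betaCoeff (2 * k) j b * gaussMoment j * (2 * √t) ^ j)
            - theta (2 * k) b / (2 * k).factorial * (2 * √t) ^ (2 * k) *
              (Real.log (2 * √t) * gaussMoment (2 * k) + gaussLogMoment (2 * k))))) := by
      rw [hsum, ← hcoef, hlog, htk, theta_two_mul_reflect hab, mul_pow]
      ring
    simp only [hk]
    rw [hmain, show ((N : ℝ) + 1) / 2 = ((N + 1 : ℕ) : ℝ) / 2 by push_cast; ring, hpow, norm_mul,
      Real.norm_of_nonneg (inv_nonneg.2 hpi.le), Real.norm_of_nonneg (pow_nonneg hst.le _)]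
    refine (mul_le_mul_of_nonneg_left ((norm_add_le _ _).trans (add_le_add hA hB))
      (inv_nonneg.2 hpi.le)).trans_eq ?_
    rw [mul_pow]
    ring
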